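/- Let $\mathcal{A}$ be an abelian category. Let $\mathcal{D}=(\mathbf{D}(\mathcal{A})_{\leq 0},\mathbf{D}(\mathcal{A})_{\geq 0})$ be the standard $t$-structure on the unbounded derived category $\mathbf{D}(\mathcal{A})$, where $\mathbf{D}(\mathcal{A})_{\leq n}$ (resp. $\mathbf{D}(\mathcal{A})_{\geq n}$) consists of the complexes $X$ with $H^i(X)=0$ for all $i>n$ (resp. for all $i<n$), and let $\mathcal{D}^b$ be its restriction to the full triangulated subcategory of $\mathbf{D}(\mathcal{A})$ formed by the complexes $X$ with $H^i(X)\neq 0$ for only finitely many $i$. For a $t$-structure $\mathcal{U}$ on a triangulated category $\mathcal{T}$, with suspension $\Sigma$ and $\mathcal{U}_{\leq n}=\Sigma^{-n}\,\mathcal{U}_{\leq 0}$, let $\mathrm{gl.dim}(\mathcal{U})$ be the smallest natural number $d\geq 0$ such that $\mathrm{Hom}_{\mathcal{T}}(X,Y)=0$ for all $X\in\mathcal{U}_{\geq 0}$ and $Y\in\mathcal{U}_{\leq -(d+1)}$, and $+\infty$ if no such $d$ exists. Let $\mathrm{gl.dim}(\mathcal{A})\in\mathbb{N}\cup\{+\infty\}$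 be the supremum of the set of all $d\geq 0$ for which $\mathrm{Ext}^d_{\mathcal{A}}(M,N)\neq 0$ for some objects $M,N$ of $\mathcal{A}$ (so it is $0$ if this set is empty, that is, if $\mathcal{A}=0$). Then: 1. $\mathrm{gl.dim}(\mathcal{A})=\mathrm{gl.dim}(\mathcal{D}^b)\leq\mathrm{gl.dim}(\mathcal{D})$. 2. If $\mathcal{A}$ has enough projective objects or enough injective objects, then $\mathrm{gl.dim}(\mathcal{A})=\mathrm{gl.dim}(\mathcal{D}^b)=\mathrm{gl.dim}(\mathcal{D})$. -/

import Mathlib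

open CategoryTheory Limits Triangulated

universe w v u

/-- The global dimension of a t-structure `t` on a triangulated category: the smallest natural
number `d` such that every morphism from an object of `t_{≥ 0}` to an object of `t_{≤ -(d+1)}`
vanishes, and `⊤` if there is no such `d`. -/
noncomputable def CategoryTheory.Triangulated.TStructure.globalDim
    {T : Type*} [Category* T] [Preadditive T] [HasZeroObject T] [HasShift T ℤ]
    [∀ n : ℤ, (shiftFunctor T n).Additive] [Pretriangulated T] (t : TStructure T) : ℕ∞ :=
  ⨅ (d : ℕ) (_ : ∀ (X Y : T), t.ge 0 X → t.le (-((d : ℤ) + 1)) Y → ∀ f : X ⟶ Y, f = 0), (d : ℕ∞)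

/-- The global dimension of an abelian category: the supremum of the set of natural numbers `d`
such that `Ext^d(X, Y) ≠ 0` for some objects `X` and `Y`. The `Ext`-groups are taken in a universe
in which they exist for every abelian category. -/
noncomputable def abelianGlobalDim (A : Type u) [Category.{v} A] [Abelian A] : ℕ∞ :=
  letI : HasExt.{max u v} A := HasExt.standard A
  ⨆ (d : ℕ) (_ : ∃ X Y : A, Nontrivial (Abelian.Ext.{max u v} X Y d)), (d : ℕ∞)

namespace CochainComplex

variable {C : Type*} [Category* C] [Abelian C]

/-! The three dimensions form a cycle of inequalities `D ≤ A ≤ Dᵇ ≤ D`. The key is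
`exists_fac_singleFunctor`: a map from an object `≥ n` to one `≤ n` factors through a single object
in degree `n`, namely a brutal truncation. Applied in degrees `0` and `-(d+1)`, it makes any map
from `≥ 0` to `≤ -(d+1)` factor through a class in some `Ext^(d+1)(M, N)`. -/

/-- The degrees `≤ n` are closed under predecessors, so there is no boundary index at which a lift
could be obstructed. -/
lemma embeddingUpIntLE_hasLift {K : CochainComplex C ℤ} {n : ℤ} {L : ChainComplex C ℕ}
    (φ : K.restriction (ComplexShape.embeddingUpIntLE n) ⟶ L) :
    (ComplexShape.embeddingUpIntLE n).HasLift φ :=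
  fun j hj _ _ ↦ (hj.2 (j + 1) (ComplexShape.Embedding.rel _ rfl)).elim

/-- The projection from a cochain complex to its brutal truncation in degrees `≤ n`. -/
noncomputable def πStupidTruncLE (K : CochainComplex C ℤ) (n : ℤ) :
    K ⟶ K.stupidTrunc (ComplexShape.embeddingUpIntLE n) :=
  ComplexShape.Embedding.liftExtend _ (𝟙 _) (embeddingUpIntLE_hasLift _)

lemma πStupidTruncLE_naturality {K L : CochainComplex C ℤ} (g : K ⟶ L) (n : ℤ) :
    K.πStupidTruncLE n ≫ HomologicalComplex.stupidTruncMap g _ = g ≫ L.πStupidTruncLE n := by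
  apply ((ComplexShape.embeddingUpIntLE n).homEquiv K _).injective
  ext1
  refine (ComplexShape.Embedding.homRestrict_comp_extendMap _ _ _).trans ?_
  refine Eq.trans ?_ (ComplexShape.Embedding.homRestrict_precomp _ _ _).symm
  simp only [πStupidTruncLE, ComplexShape.Embedding.homRestrict_liftExtend, Category.id_comp,
    Category.comp_id]

lemma isIso_πStupidTruncLE_f (K : CochainComplex C ℤ) (n i : ℤ) (hi : i ≤ n) :
    IsIso ((K.πStupidTruncLE n).f i) := by
  obtain ⟨k, rfl⟩ := Int.exists_add_of_le hi
  refine (ComplexShape.Embedding.isIso_liftExtend_f_iff _ _ _ (i := k) ?_).2 ?_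
  · simp
  · infer_instance

instance (K : CochainComplex C ℤ) (n : ℤ) [K.IsStrictlyLE n] : IsIso (K.πStupidTruncLE n) := by
  have (i : ℤ) : IsIso ((K.πStupidTruncLE n).f i) := by
    by_cases hi : i ≤ n
    · exact K.isIso_πStupidTruncLE_f n i hi
    · exact (K.isZero_of_isStrictlyLE n i).isIso
        (isZero_of_isStrictlyLE (K.stupidTrunc (ComplexShape.embeddingUpIntLE n)) n i) _
  exact HomologicalComplex.Hom.isIso_of_components _

/-- The brutal truncation in degrees `≤ n` of a complex which is cohomologically `≥ n`
is cohomologically `≥ n`. -/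
lemma isGE_stupidTruncLE (K : CochainComplex C ℤ) (n : ℤ) [K.IsGE n] :
    CochainComplex.IsGE (K.stupidTrunc (ComplexShape.embeddingUpIntLE n)) n := by
  rw [isGE_iff]
  intro i hi
  -- As `i < n`, even `i + 1` is `≤ n`: the truncation changes nothing around `i`.
  have h₁ := K.isIso_πStupidTruncLE_f n (i - 1) (by lia)
  have h₂ := K.isIso_πStupidTruncLE_f n i (by lia)
  have h₃ := K.isIso_πStupidTruncLE_f n (i + 1) (by lia)
  have : QuasiIsoAt (K.πStupidTruncLE n) i := by
    rw [quasiIsoAt_iff' _ (i - 1) i (i + 1) (by simp) (by simp)]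
    apply +allowSynthFailures ShortComplex.quasiIso_of_epi_of_isIso_of_mono
    · exact inferInstanceAs (Epi ((K.πStupidTruncLE n).f (i - 1)))
    · exact h₂
    · exact inferInstanceAs (Mono ((K.πStupidTruncLE n).f (i + 1)))
  exact (exactAt_iff_of_quasiIsoAt (K.πStupidTruncLE n) i).1 (K.exactAt_of_isGE n i)

end CochainComplex

namespace DerivedCategory

variable {C : Type u} [Category.{v} C] [Abelian C] [HasDerivedCategory.{w} C]

/-- A morphism in the derived category from an object `≥ n` to an object `≤ n` factors through
an object of the abelian category placed in degree `n`. -/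
lemma exists_fac_singleFunctor {X Y : DerivedCategory C} (n : ℤ) [X.IsGE n] [Y.IsLE n]
    (f : X ⟶ Y) :
    ∃ (M : C) (a : X ⟶ (singleFunctor C n).obj M) (b : (singleFunctor C n).obj M ⟶ Y),
      f = a ≫ b := by
  obtain ⟨K, _, ⟨eK⟩⟩ := X.exists_iso_Q_obj_of_isGE n
  obtain ⟨L, _, ⟨eL⟩⟩ := Y.exists_iso_Q_obj_of_isLE n
  obtain ⟨K', s, hs, g, fac⟩ := right_fac (eK.inv ≫ f ≫ eL.hom)
  -- `K'` is only quasi-isomorphic to `K`, so it is `≥ n` in cohomology but not strictly.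
  have : K'.IsGE n := by
    rw [← isGE_Q_obj_iff]
    exact TStructure.t.isGE_of_iso (asIso (Q.map s)).symm n
  have := K'.isGE_stupidTruncLE n
  have : CochainComplex.IsStrictlyLE
    (K'.stupidTrunc (ComplexShape.embeddingUpIntLE n)) n := inferInstance
  obtain ⟨M, ⟨e⟩⟩ := exists_iso_singleFunctor_obj_of_isGE_of_isLE
    (Q.obj (K'.stupidTrunc (ComplexShape.embeddingUpIntLE n))) n
  -- `L` is its own truncation, so `g` factors through that of `K'` by naturality.
  have hg : g = K'.πStupidTruncLE n ≫ HomologicalComplex.stupidTruncMap g _ ≫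
      inv (L.πStupidTruncLE n) := by
    rw [← Category.assoc, CochainComplex.πStupidTruncLE_naturality, Category.assoc,
      IsIso.hom_inv_id, Category.comp_id]
  refine ⟨M, eK.hom ≫ inv (Q.map s) ≫ Q.map (K'.πStupidTruncLE n) ≫ e.hom,
    e.inv ≫ Q.map (HomologicalComplex.stupidTruncMap g _ ≫ inv (L.πStupidTruncLE n)) ≫ eL.inv, ?_⟩
  rw [← cancel_epi eK.inv, ← cancel_mono eL.hom, Category.assoc, fac]
  simp only [Category.assoc, Iso.inv_hom_id_assoc, Iso.hom_inv_id_assoc, Iso.inv_hom_id,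
    Category.comp_id]
  rw [← Q.map_comp, ← hg]

universe w₀ in
/-- The vanishing of `Ext^n` is equivalent to the vanishing of the morphisms between objects of
the abelian category placed in degrees `0` and `-n`. -/
lemma subsingleton_ext_iff [HasExt.{w₀} C] (M N : C) (n : ℕ) :
    Subsingleton (Abelian.Ext.{w₀} M N n) ↔
      Subsingleton ((singleFunctor C 0).obj M ⟶ (singleFunctor C (-n)).obj N) :=
  (Abelian.Ext.homEquiv.trans
    (((singleFunctors C).shiftIso (n : ℤ) (-n) 0 (by simp)).app N).homToEquiv).subsingleton_congr

lemma bounded_singleFunctor_obj (M : C) (n : ℤ) :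
    (TStructure.t : TStructure (DerivedCategory C)).bounded ((singleFunctor C n).obj M) :=
  ⟨⟨n, inferInstance⟩, ⟨n, inferInstance⟩⟩

end DerivedCategory

lemma CategoryTheory.Triangulated.TStructure.globalDim_onBounded_le
    {T : Type*} [Category* T] [Preadditive T] [HasZeroObject T] [HasShift T ℤ]
    [∀ n : ℤ, (shiftFunctor T n).Additive] [Pretriangulated T] [IsTriangulated T]
    (t : TStructure T) :
    t.onBounded.globalDim ≤ t.globalDim :=
  le_iInf₂ fun d hd ↦ iInf₂_le d fun X Y hX hY f ↦
    t.bounded.ι.map_injective ((hd X.obj Y.obj hX hY f.hom).trans (by simp))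

open DerivedCategory

section

variable (A : Type u) [Category.{v} A] [Abelian A] [HasDerivedCategory.{w} A]

lemma globalDim_t_le_abelianGlobalDim :
    (DerivedCategory.TStructure.t : TStructure (DerivedCategory A)).globalDim ≤
      abelianGlobalDim A := by
  let : HasExt.{max u v} A := HasExt.standard A
  obtain h | ⟨d, hd⟩ : abelianGlobalDim A = ⊤ ∨ ∃ d : ℕ, (d : ℕ∞) = abelianGlobalDim A :=
    (eq_or_ne _ _).imp_right ENat.ne_top_iff_exists.1
  · simp [h]
  rw [← hd]
  refine iInf₂_le d fun X Y hX hY f ↦ ?_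
  have : X.IsGE 0 := ⟨hX⟩
  have : Y.IsLE (-((d + 1 : ℕ) : ℤ)) := ⟨by simpa using hY⟩
  have : Y.IsLE 0 := TStructure.t.isLE_of_le Y (-((d + 1 : ℕ) : ℤ)) 0 (by lia)
  obtain ⟨M, a, b, rfl⟩ := exists_fac_singleFunctor 0 f
  have : ((singleFunctor A 0).obj M).IsGE (-((d + 1 : ℕ) : ℤ)) :=
    TStructure.t.isGE_of_ge _ (-((d + 1 : ℕ) : ℤ)) 0 (by lia)
  -- Second factorization: `c` is now a map from `M` in degree `0` to `N` in degree `-(d+1)`, that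
  -- is, a class in `Ext^(d+1)(M, N)`.
  obtain ⟨N, c, e, rfl⟩ := exists_fac_singleFunctor (-((d + 1 : ℕ) : ℤ)) b
  have : Subsingleton (Abelian.Ext.{max u v} M N (d + 1)) := by
    by_contra h
    rw [not_subsingleton_iff_nontrivial] at h
    have hle : ((d + 1 : ℕ) : ℕ∞) ≤ abelianGlobalDim A :=
      le_iSup₂_of_le (d + 1) ⟨M, N, h⟩ le_rfl
    rw [← hd, Nat.cast_le] at hle
    lia
  rw [subsingleton_ext_iff] at this
  rw [Subsingleton.elim c 0, zero_comp, comp_zero]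

/-- Single objects are bounded, so nonzero `Ext` classes are already maps in the bounded
subcategory. -/
lemma abelianGlobalDim_le_globalDim_onBounded :
    abelianGlobalDim A ≤
      (DerivedCategory.TStructure.t : TStructure (DerivedCategory A)).onBounded.globalDim := by
  let : HasExt.{max u v} A := HasExt.standard A
  refine iSup₂_le fun e ⟨M, N, h⟩ ↦ le_iInf₂ fun d hd ↦ ?_
  by_contra! hlt
  rw [Nat.cast_lt] at hlt
  rw [← not_subsingleton_iff_nontrivial, subsingleton_ext_iff] at h
  have hzero (f : (singleFunctor A 0).obj M ⟶ (singleFunctor A (-(e : ℤ))).obj N) : f = 0 := by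
    -- If `d < e`, then `-e ≤ -(d+1)`, so `N` in degree `-e` falls under `hd`.
    have hY := TStructure.t.isLE_of_le ((singleFunctor A (-(e : ℤ))).obj N)
      (-(e : ℤ)) (-((d : ℤ) + 1)) (by lia)
    have hX : ((singleFunctor A 0).obj M).IsGE 0 := inferInstance
    exact congrArg (·.hom) (hd ⟨_, bounded_singleFunctor_obj M 0⟩
      ⟨_, bounded_singleFunctor_obj N (-(e : ℤ))⟩ hX.ge hY.le (ObjectProperty.homMk f))
  exact h ⟨fun f g ↦ (hzero f).trans (hzero g).symm⟩

end

theorem proposition3p6 (A : Type u) [Category.{v} A] [Abelian A] [HasDerivedCategory.{w} A] :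
    (abelianGlobalDim A =
        (DerivedCategory.TStructure.t : TStructure (DerivedCategory A)).onBounded.globalDim ∧
      (DerivedCategory.TStructure.t : TStructure (DerivedCategory A)).onBounded.globalDim ≤
        (DerivedCategory.TStructure.t : TStructure (DerivedCategory A)).globalDim) ∧
    (EnoughProjectives A ∨ EnoughInjectives A →
      abelianGlobalDim A =
        (DerivedCategory.TStructure.t : TStructure (DerivedCategory A)).onBounded.globalDim ∧
      (DerivedCategory.TStructure.t : TStructure (DerivedCategory A)).onBounded.globalDim =
        (DerivedCategory.TStructure.t : TStructure (DerivedCategory A)).globalDim) := by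
  have h₁ := abelianGlobalDim_le_globalDim_onBounded A
  have h₂ := (TStructure.t : TStructure (DerivedCategory A)).globalDim_onBounded_le
  have h₃ := globalDim_t_le_abelianGlobalDim A
  have h := h₁.antisymm (h₂.trans h₃)
  exact ⟨⟨h, h₂⟩, fun _ ↦ ⟨h, h₂.antisymm (h₃.trans h₁)⟩⟩
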